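/- Let $S_0=a$ and $S_k=\phi(S_{k-1})$ for $k\ge 1$, where $\phi$ is the morphism $\phi(a)=ab$, $\phi(b)=aa$ (the period-doubling sequences), and let $n_k=|S_k|=2^k$. The LZ-End factorization of a string $w$ is the factorization $w=q_1\cdots q_{z}$ into non-empty phrases such that, for each $i$, $q_i$ without its last character is the longest prefix of $q_i\cdots q_z$ that is a suffix of $q_1\cdots q_j$ for some $0\le j<i$; as an exception, the last phrase $q_z$ may itself be a suffix of $q_1\cdots q_j$ for some $j<z$. Write $z(w)$ for the number of phrases, $\mathrm{LZE}(w)[i]$ for the $i$-th phrase and $\mathrm{last}(w)=\mathrm{LZE}(w)[z(w)]$. Then for every $k\ge 5$: (I) $\mathrm{LZE}(S_k)[i]=\mathrm{LZE}(S_{k-1})[i]$ for every $1\le i\le z(S_{k-1})-1$. (II) $z(S_k)\ge z(S_{k-1})+1$. For $k\ge5$ let $w_k=\mathrm{LZE}(S_k)[z(S_{k-1})]$, $x_k=\mathrm{LZE}(S_k)[z(S_{k-1})+1]$, and let $y_k$ be the (possibly empty) suffix of $S_k$ that follows the phrase $x_k$. (III) If $w_k\ne \mathrm{last}(S_{k-1})$,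 then $$|w_k|=\tfrac18 n_k+1,\quad |x_k|=\tfrac38 n_k,\quad |y_k|=\tfrac3{16}n_{\ell(k)}-(k-\ell(k))-1,$$ where $\ell(k)=\max\{i \mid 5\le i\le k,\ w_i=\mathrm{last}(S_{i-1})\}$ (this maximum exists). If $w_k=\mathrm{last}(S_{k-1})$, then $$|w_k|=\tfrac3{16}n_k,\quad |x_k|=\tfrac5{16}n_k+1,\quad |y_k|=\tfrac3{16}n_k-1.$$ (IV) If $|y_k|\ge2$, then $y_k$ without its last character has another occurrence in $S_k$, to the left, which ends at the end of some LZ-End phrase of $S_k$ preceding $y_k$. If $y_k$ is not empty, then $y_k$ is the last LZ-End phrase of $S_k$ (its phrase number $z(S_{k-1})+2$). -/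

import Mathlib

namespace LZEnd

section Factorization

variable {α : Type*}

/-- `s` occurs as a suffix of `q_1 ⋯ q_j` for some `j ≤ i`, where `done = [q_1, …, q_i]` is the
list of the phrases found so far (`j = 0` gives the empty string). -/
def EndsAtPhrase (done : List (List α)) (s : List α) : Prop :=
  ∃ j ≤ done.length, s <:+ (done.take j).flatten

/-- `p` is an admissible next phrase after the phrases `done`, when `rest` is the part of the
string that is not yet factorized: `p` without its last character is the longest prefix of `rest`
that ends at an earlier phrase boundary; as an exception, `p` may be all of `rest` (hence the last
phrase) if `rest` itself ends at an earlier phrase boundary. -/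
def IsPhrase (done : List (List α)) (rest p : List α) : Prop :=
  p ≠ [] ∧ p <+: rest ∧
    ((EndsAtPhrase done p.dropLast ∧
        ∀ s, s <+: rest → EndsAtPhrase done s → s.length ≤ p.dropLast.length) ∨
      (p = rest ∧ EndsAtPhrase done p))

/-- `q` is an LZ-End factorization of `w`. -/
def IsFactorization (w : List α) (q : List (List α)) : Prop :=
  q.flatten = w ∧ ∀ (i : ℕ) (h : i < q.length), IsPhrase (q.take i) (q.drop i).flatten q[i]

lemma endsAtPhrase_nil (done : List (List α)) : EndsAtPhrase done [] :=
  ⟨0, Nat.zero_le _, List.nil_suffix⟩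

variable [DecidableEq α]

instance (done : List (List α)) (s : List α) : Decidable (EndsAtPhrase done s) :=
  decidable_of_iff (∃ j, j < done.length + 1 ∧ s <:+ (done.take j).flatten) (by
    simp [EndsAtPhrase])

/-- The length of the longest prefix of `rest` that ends at an earlier phrase boundary. -/
def sourceLength (done : List (List α)) (rest : List α) : ℕ :=
  Nat.findGreatest (fun m => EndsAtPhrase done (rest.take m)) rest.length

/-- The phrases of the LZ-End factorization that follow the phrases `done`, when `rest` is the part
of the string that is not yet factorized. (If the source is all of `rest`, then `take` returns
`rest`, the exceptional last phrase.) -/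
def phrasesFrom (done : List (List α)) (rest : List α) : List (List α) :=
  if rest = [] then []
  else
    rest.take (sourceLength done rest + 1) ::
      phrasesFrom (done ++ [rest.take (sourceLength done rest + 1)])
        (rest.drop (sourceLength done rest + 1))
termination_by rest.length
decreasing_by
  have := List.length_pos_iff.mpr ‹_›
  simp only [List.length_drop]
  omega

/-- The LZ-End factorization of `w`. -/
def factorization (w : List α) : List (List α) := phrasesFrom [] w

/-- The number of LZ-End phrases of `w`. -/
def numPhrases (w : List α) : ℕ := (factorization w).length

/-- The `i`-th LZ-End phrase of `w`, for `1 ≤ i ≤ numPhrases w` (the empty string beyond). -/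
def phrase (w : List α) (i : ℕ) : List α := (factorization w).getD (i - 1) []

/-- The last LZ-End phrase of `w`. -/
def lastPhrase (w : List α) : List α := phrase w (numPhrases w)

lemma endsAtPhrase_source (done : List (List α)) (rest : List α) :
    EndsAtPhrase done (rest.take (sourceLength done rest)) :=
  Nat.findGreatest_spec (P := fun m => EndsAtPhrase done (rest.take m)) (Nat.zero_le _)
    (by simpa using endsAtPhrase_nil done)

lemma length_le_sourceLength {done : List (List α)} {rest s : List α} (hs : s <+: rest)
    (h : EndsAtPhrase done s) : s.length ≤ sourceLength done rest := by
  refine Nat.le_findGreatest hs.length_le ?_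
  rwa [← List.prefix_iff_eq_take.mp hs]

lemma sourceLength_le (done : List (List α)) (rest : List α) :
    sourceLength done rest ≤ rest.length := Nat.findGreatest_le _

/-- The next phrase is uniquely determined. -/
lemma isPhrase_iff {done : List (List α)} {rest p : List α} (hr : rest ≠ []) :
    IsPhrase done rest p ↔ p = rest.take (sourceLength done rest + 1) := by
  have hle := sourceLength_le done rest
  have hsrc := endsAtPhrase_source done rest
  have hpos := List.length_pos_iff.mpr hr
  constructor
  · rintro ⟨hne, hp, ⟨h1, h2⟩ | ⟨rfl, h⟩⟩
    · have ha := length_le_sourceLength ((List.dropLast_prefix p).trans hp) h1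
      have hb := h2 _ (List.take_prefix _ _) hsrc
      have hp0 := List.length_pos_iff.mpr hne
      simp only [List.length_take, List.length_dropLast] at ha hb
      rw [List.prefix_iff_eq_take.mp hp]
      congr 1
      omega
    · have := length_le_sourceLength (List.prefix_refl p) h
      rw [List.take_of_length_le (by omega)]
  · rintro rfl
    refine ⟨?_, List.take_prefix _ _, ?_⟩
    · rw [← List.length_pos_iff, List.length_take]
      omega
    · rcases hle.lt_or_eq with hlt | heq
      · left
        have hd : (rest.take (sourceLength done rest + 1)).dropLast
            = rest.take (sourceLength done rest) := by
          rw [List.dropLast_eq_take, List.take_take, List.length_take]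
          congr 1
          omega
        rw [hd]
        refine ⟨hsrc, fun s hs h => ?_⟩
        rw [List.length_take, Nat.min_eq_left hle]
        exact length_le_sourceLength hs h
      · right
        rw [List.take_of_length_le (by omega)]
        rw [List.take_of_length_le (by omega)] at hsrc
        exact ⟨rfl, hsrc⟩

lemma eq_phrasesFrom_iff (t : List (List α)) : ∀ (done : List (List α)) (rest : List α),
    (t.flatten = rest ∧ ∀ (i : ℕ) (h : i < t.length),
      IsPhrase (done ++ t.take i) (t.drop i).flatten t[i]) ↔ t = phrasesFrom done rest := by
  induction t with
  | nil =>
    intro done rest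
    rw [phrasesFrom]
    by_cases hr : rest = []
    · simp [hr]
    · simp [hr, Ne.symm hr]
  | cons p t ih =>
    intro done rest
    rw [phrasesFrom]
    by_cases hr : rest = []
    · subst hr
      simp only [if_true, reduceCtorEq, iff_false, not_and]
      intro h1 h2
      have := (h2 0 (by simp)).1
      simp_all
    · rw [if_neg hr, List.cons.injEq, ← ih]
      constructor
      · rintro ⟨h1, h2⟩
        have h0 := h2 0 (by simp)
        simp only [List.take_zero, List.append_nil, List.drop_zero, List.getElem_cons_zero,
          h1] at h0
        have hp := (isPhrase_iff hr).mp h0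
        refine ⟨hp, ?_, fun i hi => ?_⟩
        · rw [List.flatten_cons] at h1
          have h3 : p ++ t.flatten = p ++ rest.drop (sourceLength done rest + 1) := by
            rw [h1]
            conv_rhs => rw [hp]
            exact (List.take_append_drop _ _).symm
          exact List.append_cancel_left h3
        · rw [← hp]
          have := h2 (i + 1) (by simpa using hi)
          rw [List.getElem_cons_succ] at this
          simpa using this
      · rintro ⟨hp, h1, h2⟩
        have h3 : (p :: t).flatten = rest := by
          rw [List.flatten_cons, h1, hp, List.take_append_drop]
        refine ⟨h3, fun i hi => ?_⟩
        cases i with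
        | zero =>
          simp only [List.take_zero, List.append_nil, List.drop_zero, List.getElem_cons_zero, h3]
          exact (isPhrase_iff hr).mpr hp
        | succ i =>
          have := h2 i (by simpa using hi)
          rw [← hp] at this
          simpa using this

/-- Every string has exactly one LZ-End factorization, namely `factorization w`. -/
theorem isFactorization_iff (w : List α) (q : List (List α)) :
    IsFactorization w q ↔ q = factorization w := by
  simpa [IsFactorization, factorization] using eq_phrasesFrom_iff q [] w

end Factorization

/-- The period-doubling morphism `a ↦ ab`, `b ↦ aa`, where `a = false` and `b = true`. -/
def morphism : Bool → List Bool
  | false => [false, true]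
  | true => [false, false]

/-- The `k`-th period-doubling sequence `S_k`. -/
def S : ℕ → List Bool
  | 0 => [false]
  | k + 1 => (S k).flatMap morphism

/-- `w_k`, the phrase of `S_k` whose number is the number of phrases of `S_{k-1}`. -/
def w (k : ℕ) : List Bool := phrase (S k) (numPhrases (S (k - 1)))

/-- `x_k`, the phrase of `S_k` that follows `w_k`. -/
def x (k : ℕ) : List Bool := phrase (S k) (numPhrases (S (k - 1)) + 1)

/-- `y_k`, the suffix of `S_k` that remains after the phrase `x_k`. -/
def y (k : ℕ) : List Bool :=
  (S k).drop ((factorization (S k)).take (numPhrases (S (k - 1)) + 1)).flatten.length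

/-- `n_k = 2 ^ k`, the length of `S_k`. -/
def n (k : ℕ) : ℕ := 2 ^ k

lemma length_S (k : ℕ) : (S k).length = n k := by
  have hm : ∀ l : List Bool, (l.flatMap morphism).length = l.length * 2 := by
    intro l
    induction l with
    | nil => rfl
    | cons c l ih => cases c <;> simp [morphism, ih] <;> omega
  induction k with
  | zero => rfl
  | succ k ih => rw [S, hm, ih, n, n, pow_succ]

end LZEnd

/-! `S k` is the prefix of length 2^k of the infinite word `pd`, whose i-th letter is the parity of
the 2-adic valuation of i, so comparing factors becomes arithmetic of valuations.

Write M = 2^j. By induction on j, all long prefixes share phrases that end Y letters before position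
16M, the end of `S (j + 4)`. If Y > 0, the next two phrases have lengths 4M + 1 and 12M; both
sources end at 16M - Y, at shifts 4M and 16M, and the deficit measured at 32M is Y - 1. If Y = 0,
one phrase of length 10M + 1 copies the prefix of length 10M, and the deficit becomes 6M - 1. So y_k
loses one letter per step and is reset once it is empty, which gives (III).

Maximality of the sources rests on `lt_of_pd_shift`: a shift by 2^s times an odd number preserves
fewer than 3 * 2^s letters. Few shifts survive; each one either puts the end of the source where no
phrase ends or matches two positions whose valuations have opposite parity. `State` carries the
facts about phrase ends that this requires. -/

namespace LZEnd

/-! ### The period-doubling word through 2-adic valuations -/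

/-- The parity of the number of trailing binary zeros of `i`, with recursion depth bounded by the
first argument. -/
def parityTrailingZeros : ℕ → ℕ → Bool
  | 0, _ => false
  | f + 1, i => if i % 2 = 1 then false else !parityTrailingZeros f (i / 2)

/-- The infinite period-doubling word, indexed from `1`: its `i`-th letter is the parity of the
2-adic valuation of `i`. -/
def pd (i : ℕ) : Bool := parityTrailingZeros i i

lemma parityTrailingZeros_eq {i : ℕ} (hi : 0 < i) {f g : ℕ} (hf : i ≤ f) (hg : i ≤ g) :
    parityTrailingZeros f i = parityTrailingZeros g i := by
  induction f generalizing i g with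
  | zero => omega
  | succ f ih =>
    obtain ⟨g, rfl⟩ : ∃ g', g = g' + 1 := ⟨g - 1, by omega⟩
    simp only [parityTrailingZeros]
    split_ifs with h
    · rfl
    · rw [ih (by omega) (by omega) (show i / 2 ≤ g by omega)]

lemma pd_odd (a : ℕ) : pd (2 * a + 1) = false := by
  simp [pd, parityTrailingZeros, Nat.add_mod]

lemma pd_two_mul {a : ℕ} (ha : 0 < a) : pd (2 * a) = !pd a := by
  obtain ⟨b, rfl⟩ : ∃ b, a = b + 1 := ⟨a - 1, by omega⟩
  rw [pd, show 2 * (b + 1) = (2 * b + 1) + 1 by ring, parityTrailingZeros, if_neg (by omega), pd,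
    show (2 * b + 1 + 1) / 2 = b + 1 by omega]
  rw [parityTrailingZeros_eq (by omega) (by omega) le_rfl]

lemma pd_pow_mul_odd (s a : ℕ) : pd (2 ^ s * (2 * a + 1)) = s.bodd := by
  induction s with
  | zero => simp [pd_odd]
  | succ s ih => rw [pow_succ', mul_assoc, pd_two_mul (by positivity), ih, Nat.bodd_succ]

lemma pd_pow (s : ℕ) : pd (2 ^ s) = s.bodd := by
  simpa using pd_pow_mul_odd s 0

lemma pd_mul_add {s i : ℕ} (a : ℕ) (hi : 0 < i) (his : i < 2 ^ s) :
    pd (2 ^ s * a + i) = pd i := by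
  induction s generalizing i with
  | zero => simp at his; omega
  | succ s ih =>
    rw [pow_succ'] at his ⊢
    obtain ⟨b, rfl | rfl⟩ := Nat.even_or_odd' i
    · rw [show 2 * 2 ^ s * a + 2 * b = 2 * (2 ^ s * a + b) by ring, pd_two_mul (by omega),
        pd_two_mul (by omega), ih (by omega) (by omega)]
    · rw [show 2 * 2 ^ s * a + (2 * b + 1) = 2 * (2 ^ s * a + b) + 1 by ring, pd_odd, pd_odd]

/-- Subtraction from a multiple of 2^s preserves valuations below s. This mirror symmetry compares
the letters that precede two multiples of a power of two. -/
lemma pd_of_add_eq_mul {s i j a : ℕ} (hi : 0 < i) (his : i < 2 ^ s) (h : j + i = 2 ^ s * a) :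
    pd j = pd i := by
  induction s generalizing i j with
  | zero => simp at his; omega
  | succ s ih =>
    rw [pow_succ'] at his h
    rw [mul_assoc] at h
    obtain ⟨b, rfl | rfl⟩ := Nat.even_or_odd' i
    · obtain ⟨c, rfl⟩ : ∃ c, j = 2 * c := ⟨j / 2, by omega⟩
      have hc : 0 < c := by
        rcases Nat.eq_zero_or_pos a with rfl | ha
        · simp at h; omega
        · have := Nat.le_mul_of_pos_right (2 ^ s) ha
          omega
      rw [pd_two_mul hc, pd_two_mul (by omega), ih (i := b) (by omega) (by omega) (by omega)]
    · obtain ⟨c, rfl⟩ : ∃ c, j = 2 * c + 1 := ⟨j / 2, by omega⟩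
      rw [pd_odd, pd_odd]

/-- Two occurrences at distance `2 ^ s * (2 * a + 1)` agree on fewer than `3 * 2 ^ s` letters. -/
lemma lt_of_pd_shift {q s a m : ℕ}
    (h : ∀ i, 0 < i → i ≤ m → pd (q + 2 ^ s * (2 * a + 1) + i) = pd (q + i)) :
    m < 3 * 2 ^ s := by
  by_contra! hm
  have hpos : 0 < 2 ^ s := by positivity
  have hdiv := Nat.div_add_mod q (2 ^ s)
  have hmod := Nat.mod_lt q hpos
  set c := q / 2 ^ s
  have key : ∀ b, 1 ≤ b → b ≤ 3 →
      pd (2 ^ s * (c + b + (2 * a + 1))) = pd (2 ^ s * (c + b)) := by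
    intro b hb1 hb3
    have hb : 2 ^ s * 1 ≤ 2 ^ s * b := Nat.mul_le_mul_left _ hb1
    have hb' : 2 ^ s * b ≤ 2 ^ s * 3 := Nat.mul_le_mul_left _ hb3
    have := h (2 ^ s * (c + b) - q) (by rw [mul_add]; omega) (by rw [mul_add]; omega)
    rw [show q + (2 ^ s * (c + b) - q) = 2 ^ s * (c + b) by rw [mul_add]; omega] at this
    rw [← this]
    congr 1
    simp only [mul_add]
    omega
  have hodd : ∀ v, v % 2 = 1 → pd (2 ^ s * v) = s.bodd := by
    intro v hv
    rw [show v = 2 * (v / 2) + 1 by omega, pd_pow_mul_odd]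
  have htwo : ∀ v, v % 4 = 2 → pd (2 ^ s * v) = !s.bodd := by
    intro v hv
    rw [show v = 2 * (2 * (v / 4) + 1) by omega, ← mul_assoc, ← pow_succ, pd_pow_mul_odd,
      Nat.bodd_succ]
  -- Each alternative holds for one class of b modulo 4, and the two classes differ because the
  -- shift is odd; hence one of them is not 0. For that b one multiplier is 2 modulo 4 and the other
  -- is odd, so the valuations are s + 1 and s.
  have hb : ∃ b, 1 ≤ b ∧ b ≤ 3 ∧ ((c + b) % 4 = 2 ∨ (c + b + (2 * a + 1)) % 4 = 2) := by
    by_cases h1 : (c + 1) % 4 = 2 ∨ (c + 1 + (2 * a + 1)) % 4 = 2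
    · exact ⟨1, by omega, by omega, h1⟩
    by_cases h2 : (c + 2) % 4 = 2 ∨ (c + 2 + (2 * a + 1)) % 4 = 2
    · exact ⟨2, by omega, by omega, h2⟩
    exact ⟨3, by omega, by omega, by omega⟩
  obtain ⟨b, hb1, hb3, hb | hb⟩ := hb
  · have := key b hb1 hb3
    rw [htwo _ hb, hodd _ (by omega)] at this
    simp at this
  · have := key b hb1 hb3
    rw [htwo _ hb, hodd _ (by omega)] at this
    simp at this

/-! ### Factors of the word and the morphism -/

/-- The factor of the period-doubling word of length `m` that follows its first `u` letters. -/
def seg (u m : ℕ) : List Bool := (List.range m).map fun i => pd (u + (i + 1))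

@[simp] lemma length_seg (u m : ℕ) : (seg u m).length = m := by simp [seg]

@[simp] lemma seg_zero (u : ℕ) : seg u 0 = [] := rfl

lemma seg_add (u m r : ℕ) : seg u (m + r) = seg u m ++ seg (u + m) r := by
  simp [seg, List.range_add, Function.comp_def, add_assoc]

lemma take_seg {u m r : ℕ} (h : m ≤ r) : (seg u r).take m = seg u m := by
  obtain ⟨c, rfl⟩ := Nat.exists_eq_add_of_le h
  rw [seg_add, List.take_left' (length_seg _ _)]

lemma drop_seg (u m r : ℕ) : (seg u (m + r)).drop m = seg (u + m) r := by
  rw [seg_add, List.drop_left' (length_seg _ _)]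

lemma dropLast_seg (u m : ℕ) : (seg u m).dropLast = seg u (m - 1) := by
  rw [List.dropLast_eq_take, length_seg, take_seg (by omega)]

lemma seg_eq_iff (u v m : ℕ) :
    seg u m = seg v m ↔ ∀ i, 0 < i → i ≤ m → pd (u + i) = pd (v + i) := by
  simp only [seg, List.map_inj_left, List.mem_range]
  constructor
  · intro h i hi him
    simpa [Nat.sub_add_cancel hi] using h (i - 1) (by omega)
  · intro h i hi
    exact h (i + 1) (by omega) (by omega)

lemma seg_suffix_iff (u q m : ℕ) :
    seg u m <:+ seg 0 (q + m) ↔ ∀ i, 0 < i → i ≤ m → pd (u + i) = pd (q + i) := by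
  rw [← seg_eq_iff, List.suffix_iff_eq_drop]
  simp [drop_seg]

lemma flatMap_morphism_seg (m : ℕ) : (seg 0 m).flatMap morphism = seg 0 (m * 2) := by
  induction m with
  | zero => rfl
  | succ m ih =>
    rw [seg_add, List.flatMap_append, ih, add_mul, seg_add]
    congr 1
    have h1 := pd_odd m
    have h2 := pd_two_mul (Nat.succ_pos m)
    rw [Nat.succ_eq_add_one] at h2
    simp only [seg, List.map_cons, List.map_nil, List.flatMap_cons,
      List.flatMap_nil, List.append_nil, zero_add, one_mul, List.range_succ, List.range_zero,
      List.nil_append, List.cons_append]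
    rw [show m * 2 + 1 = 2 * m + 1 by ring, show m * 2 + (1 + 1) = 2 * (m + 1) by ring, h1, h2]
    cases pd (m + 1) <;> rfl

lemma S_eq_seg (k : ℕ) : S k = seg 0 (2 ^ k) := by
  induction k with
  | zero => decide
  | succ k ih => rw [S, ih, flatMap_morphism_seg, pow_succ]

/-! ### Greedy factorization of the infinite word -/

section Greedy

/-- `D` are the first phrases of the LZ-End factorization of the infinite period-doubling word,
`B` is the set of the positions at which they end (including `0`), and `u` is their total
length. -/
structure Greedy (D : List (List Bool)) (B : Set ℕ) (u : ℕ) : Prop where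
  flatten : D.flatten = seg 0 u
  ends : ∀ s, EndsAtPhrase D s ↔ ∃ e ∈ B, s <:+ seg 0 e
  fact : ∀ r, factorization (seg 0 (u + r)) = D ++ phrasesFrom D (seg u r)

lemma greedy_nil : Greedy [] {0} 0 where
  flatten := rfl
  ends s := by simp [EndsAtPhrase]
  fact r := by simp [factorization]

lemma endsAtPhrase_concat {α : Type*} (D : List (List α)) (p s : List α) :
    EndsAtPhrase (D ++ [p]) s ↔ EndsAtPhrase D s ∨ s <:+ D.flatten ++ p := by
  constructor
  · rintro ⟨j, hj, h⟩
    rcases Nat.lt_or_ge D.length j with hlt | hle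
    · right
      rw [List.take_of_length_le (by simp; omega)] at h
      simpa using h
    · left
      rw [List.take_append_of_le_length hle] at h
      exact ⟨j, hle, h⟩
  · rintro (⟨j, hj, h⟩ | h)
    · exact ⟨j, by simp; omega, by rwa [List.take_append_of_le_length hj]⟩
    · exact ⟨D.length + 1, by simp, by
        rw [List.take_of_length_le (by simp)]; simpa using h⟩

lemma Greedy.sourceLength_eq {D : List (List Bool)} {B : Set ℕ} {u L r : ℕ} (hD : Greedy D B u)
    (hL : ∃ e ∈ B, seg u L <:+ seg 0 e) (hmax : ∀ e ∈ B, ∀ m, seg u m <:+ seg 0 e → m ≤ L)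
    (hr : L ≤ r) : sourceLength D (seg u r) = L := by
  apply le_antisymm
  · have h := endsAtPhrase_source D (seg u r)
    have hle := sourceLength_le D (seg u r)
    rw [length_seg] at hle
    rw [take_seg hle, hD.ends] at h
    obtain ⟨e, he, h⟩ := h
    exact hmax e he _ h
  · have := length_le_sourceLength (done := D) (rest := seg u r) (s := seg u L)
      (by rw [← take_seg hr]; exact List.take_prefix _ _) ((hD.ends _).2 hL)
    simpa using this

/-- Maximality is tested on the infinite word, so the phrase is the same for every prefix that
reaches its end. -/
lemma Greedy.step {D : List (List Bool)} {B : Set ℕ} {u L : ℕ} (hD : Greedy D B u)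
    (hL : ∃ e ∈ B, seg u L <:+ seg 0 e) (hmax : ∀ e ∈ B, ∀ m, seg u m <:+ seg 0 e → m ≤ L) :
    Greedy (D ++ [seg u (L + 1)]) (insert (u + (L + 1)) B) (u + (L + 1)) where
  flatten := by
    rw [List.flatten_append, hD.flatten, seg_add 0 u, zero_add]
    simp
  ends s := by
    rw [endsAtPhrase_concat, hD.ends, hD.flatten]
    simp only [Set.mem_insert_iff, exists_eq_or_imp, seg_add 0 u, zero_add]
    exact or_comm
  fact r := by
    rw [add_assoc, hD.fact, phrasesFrom, if_neg]
    · rw [hD.sourceLength_eq hL hmax (by omega), take_seg (by omega), drop_seg, List.append_assoc]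
      rfl
    · rw [← ne_eq, ← List.length_pos_iff, length_seg]
      omega

/-- If the remaining part of a prefix, without its last letter, ends at a phrase boundary, then it
is the last phrase. -/
lemma Greedy.factorization_eq_concat {D : List (List Bool)} {B : Set ℕ} {u r : ℕ}
    (hD : Greedy D B u) (hr : 0 < r) (h : ∃ e ∈ B, seg u (r - 1) <:+ seg 0 e) :
    factorization (seg 0 (u + r)) = D ++ [seg u r] := by
  -- A phrase takes one letter more than its source, so source lengths r - 1 and r both exhaust the
  -- remainder; the latter is the exceptional last phrase.
  have hle := length_le_sourceLength (done := D) (rest := seg u r) (s := seg u (r - 1))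
    (by rw [← take_seg (show r - 1 ≤ r by omega)]; exact List.take_prefix _ _)
    ((hD.ends _).2 h)
  rw [length_seg] at hle
  rw [hD.fact, phrasesFrom, if_neg, List.take_of_length_le (by rw [length_seg]; omega),
    List.drop_of_length_le (by rw [length_seg]; omega), phrasesFrom, if_pos rfl]
  rw [← ne_eq, ← List.length_pos_iff, length_seg]
  omega

lemma Greedy.factorization_eq {D : List (List Bool)} {B : Set ℕ} {u : ℕ} (hD : Greedy D B u) :
    factorization (seg 0 u) = D := by
  have := hD.fact 0
  rw [add_zero, seg_zero, phrasesFrom, if_pos rfl, List.append_nil] at this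
  exact this

end Greedy

/-! ### The inductive invariant -/

/-- The situation after the phrases `D` common to the factorizations of all long prefixes of the
period-doubling word, where `S (j + 4)` ends `Y` letters after these phrases. -/
structure State (j Y : ℕ) (D : List (List Bool)) (B : Set ℕ) : Prop where
  greedy : Greedy D B (16 * 2 ^ j - Y)
  le : ∀ e ∈ B, e ≤ 16 * 2 ^ j - Y
  mem : 16 * 2 ^ j - Y ∈ B
  bound : 16 * Y + 16 ≤ 48 * 2 ^ j
  -- No phrase ends fewer than Y letters before the midpoint; this serves to exclude the shift 12 *
  -- 2^j in `State.le_of_source_w`.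
  gap : ∀ e ∈ B, e + Y ≤ 8 * 2 ^ j ∨ 8 * 2 ^ j ≤ e
  -- The letters before 2^c and before 16 * 2^j agree by mirror symmetry, so a source for the last
  -- phrase ends at 2^c - 1.
  source : ∃ c ≤ j + 4, 2 ^ c - 1 ∈ B ∧ Y ≤ 2 ^ c
  -- Data for a reset: 10 * 2^j ends the next source, 8 * 2^j - 1 provides the next `source`, the
  -- bound on ends excludes longer sources, and v is the phrase kept in `S (j + 5)`.
  full : Y = 0 → 10 * 2 ^ j ∈ B ∧ 8 * 2 ^ j - 1 ∈ B ∧ (∀ e ∈ B, e ≤ 10 * 2 ^ j ∨ e = 16 * 2 ^ j) ∧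
    ∃ D₀ v, D = D₀ ++ [v] ∧ v.length = 6 * 2 ^ j

/-! ### Longest sources and the transitions of the invariant -/

section Bounds

variable {j Y : ℕ} {D : List (List Bool)} {B : Set ℕ}

lemma suffix_seg_elim {u m e : ℕ} (h : seg u m <:+ seg 0 e) :
    ∃ q, e = q + m ∧ ∀ i, 0 < i → i ≤ m → pd (u + i) = pd (q + i) := by
  have hle := h.length_le
  simp only [length_seg] at hle
  obtain ⟨q, rfl⟩ := Nat.exists_eq_add_of_le' hle
  exact ⟨q, rfl, (seg_suffix_iff u q m).1 h⟩

lemma pow_le_of_lt_of_mul {j s c : ℕ} (h : 2 ^ (j + c) < 2 ^ s * 2) : j + c ≤ s := by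
  rw [← pow_succ] at h
  have := (Nat.pow_lt_pow_iff_right (by norm_num : 1 < 2)).1 h
  omega

lemma lt_of_pow_mul_lt {s b : ℕ} (a : ℕ) (h : 2 ^ s * (2 * a + 1) < 2 ^ b) : s < b :=
  (Nat.pow_lt_pow_iff_right (by norm_num : 1 < 2)).1
    ((Nat.le_mul_of_pos_right _ (by omega)).trans_lt h)

/-- The shift 4M takes 16M to 12M. Around both, letters at nonzero distance below 4M depend only on
the distance, and the valuations j + 4 and j + 2 of the centres have equal parity. -/
lemma State.exists_source_w (h : State j Y D B) (hY : 0 < Y) :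
    ∃ e ∈ B, seg (16 * 2 ^ j - Y) (4 * 2 ^ j) <:+ seg 0 e := by
  have hb := h.bound
  refine ⟨_, h.mem, ?_⟩
  have hM : 0 < 2 ^ j := by positivity
  have h2 : 2 ^ (j + 2) = 4 * 2 ^ j := by ring
  rw [show seg 0 (16 * 2 ^ j - Y) = seg 0 ((12 * 2 ^ j - Y) + 4 * 2 ^ j) by congr 1; omega,
    seg_suffix_iff]
  intro i hi him
  rcases lt_trichotomy i Y with hlt | rfl | hgt
  · exact (pd_of_add_eq_mul (s := j + 2) (i := Y - i) (a := 4) (by omega) (by omega)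
      (by omega)).trans (pd_of_add_eq_mul (s := j + 2) (a := 3) (by omega) (by omega)
      (by omega)).symm
  · rw [show 16 * 2 ^ j - i + i = 2 ^ (j + 4) * (2 * 0 + 1) by rw [pow_add]; omega,
      show 12 * 2 ^ j - i + i = 2 ^ (j + 2) * (2 * 1 + 1) by rw [pow_add]; omega,
      pd_pow_mul_odd, pd_pow_mul_odd]
    simp
  · rw [show 16 * 2 ^ j - Y + i = 2 ^ (j + 2) * 4 + (i - Y) by omega,
      show 12 * 2 ^ j - Y + i = 2 ^ (j + 2) * 3 + (i - Y) by omega,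
      pd_mul_add _ (by omega) (by omega), pd_mul_add _ (by omega) (by omega)]

lemma State.le_of_source_w (h : State j Y D B) (hY : 0 < Y) :
    ∀ e ∈ B, ∀ m, seg (16 * 2 ^ j - Y) m <:+ seg 0 e → m ≤ 4 * 2 ^ j := by
  intro e he m hm
  by_contra! hlt
  have hb := h.bound
  have hM : 0 < 2 ^ j := by positivity
  obtain ⟨q, rfl, hq⟩ := suffix_seg_elim hm
  have hle := h.le _ he
  obtain ⟨s, d, ⟨a, rfl⟩, hd⟩ :=
    Nat.exists_eq_two_pow_mul_odd (n := 16 * 2 ^ j - Y - q) (by omega)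
  have hs := lt_of_pd_shift (q := q) (s := s) (a := a) (m := m) fun i hi him => by
    rw [← hq i hi him, ← hd]; congr 2; omega
  have h4 : 2 ^ (j + 4) = 16 * 2 ^ j := by ring
  have hs1 : j + 1 ≤ s := pow_le_of_lt_of_mul (by rw [pow_succ]; omega)
  have hs2 : s < j + 4 := lt_of_pow_mul_lt a (by omega)
  obtain ⟨t, rfl⟩ := Nat.exists_eq_add_of_le hs1
  have ht : t < 3 := by omega
  -- Only s = j + 1, j + 2, j + 3 remain. The letter at 16M faces the one at 16M - d, whose
  -- valuation is s, so parity leaves s = j + 2.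
  have h1 := hq Y hY (by omega)
  rw [show 16 * 2 ^ j - Y + Y = 2 ^ (j + 4) by omega, pd_pow] at h1
  have hpar : (j + 1 + t).bodd = (j + 4).bodd := by
    rw [h1]
    obtain ⟨b, hb'⟩ : ∃ b, q + Y = 2 ^ (j + 1 + t) * (2 * b + 1) := by
      refine ⟨2 ^ (2 - t) - 1 - a, ?_⟩
      have e1 : 2 ^ (j + 4) = 2 ^ (j + 1 + t) * (2 * 2 ^ (2 - t)) := by
        rw [← pow_succ', ← pow_add]; congr 1; omega
      have e2 : 2 * a + 1 < 2 * 2 ^ (2 - t) := by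
        apply lt_of_mul_lt_mul_left (a := 2 ^ (j + 1 + t)) _ (by positivity)
        omega
      rw [show 2 * (2 ^ (2 - t) - 1 - a) + 1 = 2 * 2 ^ (2 - t) - (2 * a + 1) by omega,
        Nat.mul_sub, ← e1]
      omega
    rw [hb', pd_pow_mul_odd]
  have ht1 : t = 1 := by
    interval_cases t
    · simp at hpar
    · rfl
    · simp at hpar
  subst ht1
  have h2 : 2 ^ (j + 1 + 1) = 4 * 2 ^ j := by ring
  rw [h2] at hd
  have ha : a = 0 ∨ a = 1 := by
    by_contra! hne
    have : 4 * 2 ^ j * 5 ≤ 4 * 2 ^ j * (2 * a + 1) := Nat.mul_le_mul_left _ (by omega)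
    omega
  -- Shift 4M would end the source after the last boundary. For shift 12M, `gap` forces the end to
  -- be at least 8M, so position 8M faces 20M, with valuations j + 3 and j + 2.
  rcases ha with rfl | rfl
  · omega
  · rcases h.gap _ he with hg | hg
    · omega
    · have h3 := hq (4 * 2 ^ j + Y) (by omega) (by omega)
      rw [show 16 * 2 ^ j - Y + (4 * 2 ^ j + Y) = 2 ^ (j + 2) * (2 * 2 + 1) by rw [pow_add]; omega,
        show q + (4 * 2 ^ j + Y) = 2 ^ (j + 3) by rw [pow_add]; omega, pd_pow, pd_pow_mul_odd] at h3
      simp at h3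

/-- The segment lies strictly between 16M and 32M, where subtracting 16M preserves valuations. -/
lemma State.exists_source_x (h : State j Y D B) (hY : 0 < Y) :
    ∃ e ∈ insert (16 * 2 ^ j - Y + (4 * 2 ^ j + 1)) B,
      seg (16 * 2 ^ j - Y + (4 * 2 ^ j + 1)) (12 * 2 ^ j - 1) <:+ seg 0 e := by
  have hb := h.bound
  refine ⟨_, Or.inr h.mem, ?_⟩
  have hM : 0 < 2 ^ j := by positivity
  have h4 : 2 ^ (j + 4) = 16 * 2 ^ j := by ring
  rw [show seg 0 (16 * 2 ^ j - Y) = seg 0 ((4 * 2 ^ j + 1 - Y) + (12 * 2 ^ j - 1)) by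
    congr 1; omega, seg_suffix_iff]
  intro i hi him
  rw [show 16 * 2 ^ j - Y + (4 * 2 ^ j + 1) + i = 2 ^ (j + 4) * 1 + (4 * 2 ^ j + 1 - Y + i) by
    omega, pd_mul_add _ (by omega) (by omega)]

lemma State.le_of_source_x (h : State j Y D B) (hY : 0 < Y) :
    ∀ e ∈ insert (16 * 2 ^ j - Y + (4 * 2 ^ j + 1)) B, ∀ m,
      seg (16 * 2 ^ j - Y + (4 * 2 ^ j + 1)) m <:+ seg 0 e → m ≤ 12 * 2 ^ j - 1 := by
  intro e he m hm
  by_contra! hlt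
  have hb := h.bound
  have hM : 0 < 2 ^ j := by positivity
  obtain ⟨q, rfl, hq⟩ := suffix_seg_elim hm
  have hle : q + m ≤ 16 * 2 ^ j - Y ∨ q + m = 16 * 2 ^ j - Y + (4 * 2 ^ j + 1) :=
    he.elim Or.inr fun he => Or.inl (h.le _ he)
  obtain ⟨s, d, ⟨a, rfl⟩, hd⟩ :=
    Nat.exists_eq_two_pow_mul_odd (n := 16 * 2 ^ j - Y + (4 * 2 ^ j + 1) - q) (by omega)
  have hs := lt_of_pd_shift (q := q) (s := s) (a := a) (m := m) fun i hi him => by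
    rw [← hq i hi him, ← hd]; congr 2; omega
  have h3 : 2 ^ (j + 3) = 8 * 2 ^ j := by ring
  have h5 : 2 ^ (j + 5) = 32 * 2 ^ j := by ring
  have hs1 : j + 3 ≤ s := pow_le_of_lt_of_mul (by omega)
  have hs2 : s < j + 5 := lt_of_pow_mul_lt a (by omega)
  have ha : a = 0 := by
    by_contra hne
    have e1 : 2 ^ (j + 3) ≤ 2 ^ s := Nat.pow_le_pow_right (by norm_num) hs1
    have e2 : 2 ^ s * 3 ≤ 2 ^ s * (2 * a + 1) := Nat.mul_le_mul_left _ (by omega)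
    omega
  subst ha
  -- Shift 8M ends past every boundary. Shift 16M with an end at most 16M - Y leaves only 12M - 1
  -- letters, so the source ends at the boundary just created and contains position 16M, which faces
  -- 32M.
  obtain rfl | rfl : s = j + 3 ∨ s = j + 4 := by omega
  · omega
  · have h4 : 2 ^ (j + 4) = 16 * 2 ^ j := by ring
    have h1 := hq (12 * 2 ^ j + Y - 1) (by omega) (by omega)
    rw [show 16 * 2 ^ j - Y + (4 * 2 ^ j + 1) + (12 * 2 ^ j + Y - 1) = 2 ^ (j + 5) by omega,
      show q + (12 * 2 ^ j + Y - 1) = 2 ^ (j + 4) by omega, pd_pow, pd_pow] at h1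
    simp at h1

lemma State.exists_source_full (h : State j 0 D B) :
    ∃ e ∈ B, seg (16 * 2 ^ j) (10 * 2 ^ j) <:+ seg 0 e := by
  refine ⟨_, (h.full rfl).1, ?_⟩
  have hM : 0 < 2 ^ j := by positivity
  have h4 : 2 ^ (j + 4) = 16 * 2 ^ j := by ring
  rw [show seg 0 (10 * 2 ^ j) = seg 0 (0 + 10 * 2 ^ j) by rw [zero_add], seg_suffix_iff]
  intro i hi him
  rw [show 16 * 2 ^ j + i = 2 ^ (j + 4) * 1 + i by omega, pd_mul_add _ hi (by omega), zero_add]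

lemma State.le_of_source_full (h : State j 0 D B) :
    ∀ e ∈ B, ∀ m, seg (16 * 2 ^ j) m <:+ seg 0 e → m ≤ 10 * 2 ^ j := by
  intro e he m hm
  by_contra! hlt
  have hM : 0 < 2 ^ j := by positivity
  obtain ⟨q, rfl, hq⟩ := suffix_seg_elim hm
  -- An end at most 10M is too early, so the source ends at 16M and the shift equals its length m.
  -- Then m < 3 * 2^s makes m a power of two, namely 16M.
  have hle := (h.full rfl).2.2.1 _ he
  obtain ⟨s, d, ⟨a, rfl⟩, hd⟩ := Nat.exists_eq_two_pow_mul_odd (n := m) (by omega)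
  have hs := lt_of_pd_shift (q := q) (s := s) (a := a) (m := m) fun i hi him => by
    rw [← hq i hi him, ← hd]; congr 2; omega
  have h4 : 2 ^ (j + 4) = 16 * 2 ^ j := by ring
  have h5 : 2 ^ (j + 5) = 32 * 2 ^ j := by ring
  have ha : a = 0 := by
    by_contra hne
    have e2 : 2 ^ s * 3 ≤ 2 ^ s * (2 * a + 1) := Nat.mul_le_mul_left _ (by omega)
    omega
  subst ha
  have hs1 : j + 4 ≤ s := pow_le_of_lt_of_mul (by omega)
  have hs2 : s < j + 5 := lt_of_pow_mul_lt 0 (by omega)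
  obtain rfl : s = j + 4 := by omega
  have h1 := hq (16 * 2 ^ j) (by omega) (by omega)
  rw [show 16 * 2 ^ j + 16 * 2 ^ j = 2 ^ (j + 5) by omega,
    show q + 16 * 2 ^ j = 2 ^ (j + 4) by omega, pd_pow, pd_pow] at h1
  simp at h1

/-- If the prefix of length `2 ^ (j + 4)` has an unfinished phrase, then two phrases follow. -/
lemma State.step_pos (h : State j Y D B) (hY : 0 < Y) :
    ∃ B', State (j + 1) (Y - 1)
      (D ++ [seg (16 * 2 ^ j - Y) (4 * 2 ^ j + 1)] ++
        [seg (16 * 2 ^ j - Y + (4 * 2 ^ j + 1)) (12 * 2 ^ j)]) B' := by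
  have hb := h.bound
  have hM : 0 < 2 ^ j := by positivity
  have g := (h.greedy.step (h.exists_source_w hY) (h.le_of_source_w hY)).step
    (h.exists_source_x hY) (h.le_of_source_x hY)
  rw [show 12 * 2 ^ j - 1 + 1 = 12 * 2 ^ j by omega] at g
  have hend : 16 * 2 ^ j - Y + (4 * 2 ^ j + 1) + 12 * 2 ^ j = 16 * 2 ^ (j + 1) - (Y - 1) := by
    rw [pow_succ]; omega
  rw [hend] at g
  refine ⟨_, g, ?_, Or.inl rfl, ?_, ?_, ?_, ?_⟩
  · rintro e (rfl | rfl | he)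
    · exact le_rfl
    · omega
    · have := h.le e he
      omega
  · rw [pow_succ]; omega
  · rw [pow_succ]
    rintro e (rfl | rfl | he)
    · omega
    · omega
    · have := h.le e he
      omega
  · obtain ⟨c, hc, hcB, hYc⟩ := h.source
    exact ⟨c, by omega, Or.inr (Or.inr hcB), by omega⟩
  -- Here Y = 1: the boundaries 20M and 16M - 1 are 10 * 2^(j+1) and 8 * 2^(j+1) - 1, and the last
  -- phrase has length 6 * 2^(j+1).
  · intro hY1
    rw [pow_succ]
    refine ⟨Or.inr (Or.inl ?_), Or.inr (Or.inr ?_), ?_, _, _, rfl, ?_⟩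
    · omega
    · convert h.mem using 1
      omega
    · rintro e (rfl | rfl | he)
      · right; omega
      · omega
      · have := h.le e he
        omega
    · rw [length_seg]; omega

/-- If the prefix of length `2 ^ (j + 4)` ends with a finished phrase, then one phrase follows. -/
lemma State.step_zero (h : State j 0 D B) :
    ∃ B', State (j + 1) (6 * 2 ^ j - 1) (D ++ [seg (16 * 2 ^ j) (10 * 2 ^ j + 1)]) B' := by
  have hM : 0 < 2 ^ j := by positivity
  have g := Greedy.step (by simpa using h.greedy) h.exists_source_full h.le_of_source_full
  have hend : 16 * 2 ^ j + (10 * 2 ^ j + 1) = 16 * 2 ^ (j + 1) - (6 * 2 ^ j - 1) := by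
    rw [pow_succ]; omega
  rw [hend] at g
  obtain ⟨-, hmem, hle, -⟩ := h.full rfl
  refine ⟨_, g, ?_, Or.inl rfl, ?_, ?_, ⟨j + 3, by omega, Or.inr ?_, ?_⟩, ?_⟩
  · rintro e (rfl | he)
    · exact le_rfl
    · have := h.le e he
      omega
  · rw [pow_succ]; omega
  · rw [pow_succ]
    rintro e (rfl | he)
    · omega
    · have := hle e he
      omega
  · convert hmem using 2
    ring
  · rw [pow_add]; omega
  · omega

/-- The whole remaining part is the last phrase of the factorization of `S (j + 4)`. -/
lemma State.factorization_eq (h : State j Y D B) (hY : 0 < Y) :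
    (∃ e ∈ B, seg (16 * 2 ^ j - Y) (Y - 1) <:+ seg 0 e) ∧
      factorization (S (j + 4)) = D ++ [seg (16 * 2 ^ j - Y) Y] := by
  have hb := h.bound
  have hM : 0 < 2 ^ j := by positivity
  have h4 : 2 ^ (j + 4) = 16 * 2 ^ j := by ring
  have hs : ∃ e ∈ B, seg (16 * 2 ^ j - Y) (Y - 1) <:+ seg 0 e := by
    obtain ⟨c, hc, hcB, hYc⟩ := h.source
    refine ⟨_, hcB, ?_⟩
    rw [show seg 0 (2 ^ c - 1) = seg 0 ((2 ^ c - Y) + (Y - 1)) by congr 1; omega, seg_suffix_iff]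
    intro i hi him
    exact (pd_of_add_eq_mul (s := c) (i := Y - i) (a := 2 ^ (j + 4 - c)) (by omega) (by omega)
      (by rw [← pow_add, Nat.add_sub_cancel' hc]; omega)).trans
      (pd_of_add_eq_mul (s := c) (a := 1) (by omega) (by omega) (by omega)).symm
  refine ⟨hs, ?_⟩
  rw [S_eq_seg, ← h.greedy.factorization_eq_concat hY hs]
  congr 2
  omega

lemma State.factorization_eq_of_full (h : State j 0 D B) : factorization (S (j + 4)) = D := by
  rw [S_eq_seg, show 2 ^ (j + 4) = 16 * 2 ^ j - 0 by rw [pow_add]; omega,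
    h.greedy.factorization_eq]

end Bounds

/-- The phrases of `S 4` have lengths 1, 1, 2, 3, 3, 6. A finite set of ends and the bound m ≤ e
make maximality decidable. -/
lemma exists_state_zero : ∃ D B, State 0 0 D B := by
  have step : ∀ (L : ℕ) {D : List (List Bool)} {B : Finset ℕ} {u : ℕ}, Greedy D ↑B u →
      (∃ e ∈ B, seg u L <:+ seg 0 e) →
      (∀ e ∈ B, ∀ m ∈ Finset.range (e + 1), seg u m <:+ seg 0 e → m ≤ L) →
      Greedy (D ++ [seg u (L + 1)]) ↑(insert (u + (L + 1)) B) (u + (L + 1)) := by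
    intro L D B u hD hL hmax
    rw [Finset.coe_insert]
    refine hD.step (by simpa using hL) fun e he m hm => hmax e (by simpa using he) m ?_ hm
    have := hm.length_le
    simp only [length_seg] at this
    simpa [Nat.lt_succ_iff] using this
  have g0 : Greedy [] ↑({0} : Finset ℕ) 0 := by simpa using greedy_nil
  have g1 := step 0 g0 (by decide) (by decide)
  have g2 := step 0 g1 (by decide) (by decide)
  have g3 := step 1 g2 (by decide) (by decide)
  have g4 := step 2 g3 (by decide) (by decide)
  have g5 := step 2 g4 (by decide) (by decide)
  have g6 := step 5 g5 (by decide) (by decide)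
  refine ⟨_, _, g6, ?_, ?_, by norm_num, ?_, ⟨3, by norm_num, ?_, by norm_num⟩, fun _ => 
    ⟨?_, ?_, ?_, _, _, rfl, ?_⟩⟩
  all_goals simp

/-- What remains after the phrases `D` is either empty or a single phrase. -/
lemma State.exists_factorization {j Y : ℕ} {D : List (List Bool)} {B : Set ℕ}
    (h : State j Y D B) :
    ∃ v, v.length = Y ∧ EndsAtPhrase D v.dropLast ∧
      factorization (S (j + 4)) = D ++ if v = [] then [] else [v] := by
  rcases Nat.eq_zero_or_pos Y with rfl | hY
  · exact ⟨[], rfl, endsAtPhrase_nil D, by simpa using h.factorization_eq_of_full⟩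
  · obtain ⟨hs, hf⟩ := h.factorization_eq hY
    refine ⟨seg (16 * 2 ^ j - Y) Y, length_seg _ _, ?_, ?_⟩
    · rw [dropLast_seg]
      exact (h.greedy.ends _).2 hs
    · rw [if_neg, hf]
      rw [← ne_eq, ← List.length_pos_iff, length_seg]
      exact hY

/-! ### From the invariant to numbered phrases -/

/-- The factorizations of `S (k - 1)` and `S k` are `D, v` and `D, a, b, c`, where the last phrase
is absent if `c` is empty. -/
structure Extends (k : ℕ) (D : List (List Bool)) (v a b c : List Bool) : Prop where
  prev : factorization (S (k - 1)) = D ++ [v]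
  curr : factorization (S k) = D ++ [a, b] ++ if c = [] then [] else [c]
  source : EndsAtPhrase (D ++ [a, b]) c.dropLast

namespace Extends

variable {k : ℕ} {D : List (List Bool)} {v a b c : List Bool}

lemma numPhrases_prev (h : Extends k D v a b c) : numPhrases (S (k - 1)) = D.length + 1 := by
  simp [numPhrases, h.prev]

lemma lastPhrase_prev (h : Extends k D v a b c) : lastPhrase (S (k - 1)) = v := by
  simp [lastPhrase, phrase, h.numPhrases_prev, h.prev]

lemma w_eq (h : Extends k D v a b c) : w k = a := by
  simp [w, phrase, h.numPhrases_prev, h.curr]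

lemma x_eq (h : Extends k D v a b c) : x k = b := by
  simp [x, phrase, h.numPhrases_prev, h.curr]

lemma flatten_factorization {α : Type*} [DecidableEq α] (s : List α) :
    (factorization s).flatten = s :=
  ((isFactorization_iff s _).2 rfl).1

lemma y_eq (h : Extends k D v a b c) : y k = c := by
  have hS := flatten_factorization (S k)
  have ht : (factorization (S k)).take (D.length + 1 + 1) = D ++ [a, b] := by
    rw [h.curr, List.take_left' (by simp)]
  rw [y, h.numPhrases_prev, ht, ← hS, h.curr, List.flatten_append (L₁ := D ++ [a, b]),
    List.drop_left]
  split_ifs with hc <;> simp [hc]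

lemma phrase_eq (h : Extends k D v a b c) {i : ℕ} (hi : 1 ≤ i)
    (hi' : i ≤ numPhrases (S (k - 1)) - 1) : phrase (S k) i = phrase (S (k - 1)) i := by
  rw [h.numPhrases_prev] at hi'
  rw [phrase, phrase, h.prev, h.curr, List.append_assoc, List.getD_append _ _ _ _ (by omega),
    List.getD_append _ _ _ _ (by omega)]

lemma numPhrases_le (h : Extends k D v a b c) :
    numPhrases (S (k - 1)) + 1 ≤ numPhrases (S k) := by
  rw [h.numPhrases_prev, numPhrases, h.curr]
  simp

lemma exists_source (h : Extends k D v a b c) (hc : 2 ≤ (y k).length) :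
    ∃ j : ℕ, 1 ≤ j ∧ j ≤ numPhrases (S (k - 1)) + 1 ∧
      (y k).dropLast <:+ ((factorization (S k)).take j).flatten := by
  rw [h.y_eq] at hc ⊢
  obtain ⟨j, hj, hs⟩ := h.source
  refine ⟨j, ?_, ?_, ?_⟩
  · by_contra! hj0
    obtain rfl : j = 0 := by omega
    have := hs.length_le
    simp at this
    omega
  · rw [h.numPhrases_prev]
    simpa using hj
  · rwa [h.curr, List.take_append_of_le_length hj]

lemma last_of_ne_nil (h : Extends k D v a b c) (hc : y k ≠ []) :
    numPhrases (S k) = numPhrases (S (k - 1)) + 2 ∧ lastPhrase (S k) = y k := by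
  have hy := h.y_eq
  have hcurr := h.curr
  rw [if_neg (hy ▸ hc)] at hcurr
  have hn : numPhrases (S k) = D.length + 3 := by simp [numPhrases, hcurr]
  refine ⟨by rw [hn, h.numPhrases_prev], ?_⟩
  simp [lastPhrase, phrase, hn, hcurr, hy]

end Extends

/-- If `S (j + 4)` ends with a finished phrase, then this phrase is kept in `S (j + 5)`. -/
lemma State.extends_zero {j : ℕ} {D : List (List Bool)} {B : Set ℕ} (h : State j 0 D B) :
    ∃ D' B' E a b c, State (j + 1) (6 * 2 ^ j - 1) D' B' ∧ Extends (j + 5) E a a b c ∧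
      a.length = 6 * 2 ^ j ∧ b.length = 10 * 2 ^ j + 1 ∧ c.length = 6 * 2 ^ j - 1 := by
  obtain ⟨-, -, -, E, a, rfl, ha⟩ := h.full rfl
  obtain ⟨B', h'⟩ := h.step_zero
  obtain ⟨c, hc, hsrc, hfac⟩ := h'.exists_factorization
  rw [List.append_assoc E, List.singleton_append] at hsrc hfac
  exact ⟨_, B', E, a, _, c, h', ⟨h.factorization_eq_of_full, hfac, hsrc⟩, ha, length_seg _ _, hc⟩

/-- If `S (j + 4)` ends with an unfinished phrase, then this phrase is replaced in `S (j + 5)`. -/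
lemma State.extends_pos {j Y : ℕ} {D : List (List Bool)} {B : Set ℕ} (h : State j Y D B)
    (hY : 0 < Y) :
    ∃ D' B' v a b c, State (j + 1) (Y - 1) D' B' ∧ Extends (j + 5) D v a b c ∧ a ≠ v ∧
      a.length = 4 * 2 ^ j + 1 ∧ b.length = 12 * 2 ^ j ∧ c.length = Y - 1 := by
  obtain ⟨B', h'⟩ := h.step_pos hY
  obtain ⟨c, hc, hsrc, hfac⟩ := h'.exists_factorization
  rw [List.append_assoc D, List.singleton_append] at hsrc hfac
  refine ⟨_, B', _, _, _, c, h', ⟨(h.factorization_eq hY).2, hfac, hsrc⟩, fun he => ?_,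
    length_seg _ _, length_seg _ _, hc⟩
  -- The lengths are 4 * 2^j + 1 and Y, while Y + 1 ≤ 3 * 2^j.
  have := congrArg List.length he
  have := h.bound
  simp only [length_seg] at *
  omega

/-! ### Length recursion and its closed form -/

/-- The lengths of `w_k`, `x_k` and `y_k` for `k = j + 5`, in terms of the part `Y` of `S (k - 1)`
that remains after `x_{k-1}`. -/
def LengthRecursion (j Y : ℕ) : Prop :=
  (w (j + 5) = lastPhrase (S (j + 4)) ∧ Y = 0 ∧ (w (j + 5)).length = 6 * 2 ^ j ∧
      (x (j + 5)).length = 10 * 2 ^ j + 1 ∧ (y (j + 5)).length = 6 * 2 ^ j - 1) ∨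
    (w (j + 5) ≠ lastPhrase (S (j + 4)) ∧ 0 < Y ∧ (w (j + 5)).length = 4 * 2 ^ j + 1 ∧
      (x (j + 5)).length = 12 * 2 ^ j ∧ (y (j + 5)).length = Y - 1)

lemma State.exists_next {j Y : ℕ} {D : List (List Bool)} {B : Set ℕ} (h : State j Y D B) :
    (∃ D' B', State (j + 1) (y (j + 5)).length D' B') ∧ LengthRecursion j Y ∧
      ∃ E v a b c, Extends (j + 5) E v a b c := by
  rcases Nat.eq_zero_or_pos Y with rfl | hY
  · obtain ⟨D', B', E, a, b, c, h', he, ha, hb, hc⟩ := h.extends_zero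
    have hlast : lastPhrase (S (j + 4)) = a := he.lastPhrase_prev
    refine ⟨⟨D', B', by rwa [he.y_eq, hc]⟩, Or.inl ?_, E, a, a, b, c, he⟩
    rw [he.w_eq, he.x_eq, he.y_eq, hlast]
    exact ⟨rfl, rfl, ha, hb, hc⟩
  · obtain ⟨D', B', v, a, b, c, h', he, hne, ha, hb, hc⟩ := h.extends_pos hY
    have hlast : lastPhrase (S (j + 4)) = v := he.lastPhrase_prev
    refine ⟨⟨D', B', by rwa [he.y_eq, hc]⟩, Or.inr ?_, D, v, a, b, c, he⟩
    rw [he.w_eq, he.x_eq, he.y_eq, hlast]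
    exact ⟨hne, hY, ha, hb, hc⟩

/-- The length of the part of `S (j + 4)` that is not covered by phrases common to all later
strings: it is `0` for `S 4`. -/
def remainder : ℕ → ℕ
  | 0 => 0
  | j + 1 => (y (j + 5)).length

lemma exists_state (j : ℕ) : ∃ D B, State j (remainder j) D B := by
  induction j with
  | zero => exact exists_state_zero
  | succ j ih =>
    obtain ⟨D, B, h⟩ := ih
    exact h.exists_next.1

lemma lengthRecursion (j : ℕ) : LengthRecursion j (remainder j) := by
  obtain ⟨D, B, h⟩ := exists_state j
  exact h.exists_next.2.1

lemma exists_extends (j : ℕ) : ∃ E v a b c, Extends (j + 5) E v a b c := by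
  obtain ⟨D, B, h⟩ := exists_state j
  exact h.exists_next.2.2

/-- The length of `y_k`, in terms of the last `l ≤ k` for which `w_l` is the last phrase of
`S (l - 1)`. -/
lemma exists_isGreatest_length_y (j : ℕ) :
    ∃ l, IsGreatest {i : ℕ | 5 ≤ i ∧ i ≤ j + 5 ∧ w i = lastPhrase (S (i - 1))} l ∧
      ((y (j + 5)).length : ℚ) = 3 / 16 * (n l : ℚ) - (((j + 5 : ℕ) : ℚ) - (l : ℚ)) - 1 := by
  induction j with
  | zero =>
    -- Since `remainder 0 = 0`, a reset occurs at k = 5, so the maximum exists.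
    rcases lengthRecursion 0 with ⟨hw, -, -, -, hy⟩ | ⟨-, h0, -⟩
    · refine ⟨5, ⟨⟨le_rfl, le_rfl, hw⟩, fun i hi => hi.2.1⟩, ?_⟩
      rw [hy]
      norm_num [n]
    · exact absurd h0 (by simp [remainder])
  | succ j ih =>
    rcases lengthRecursion (j + 1) with ⟨hw, -, -, -, hy⟩ | ⟨hw, hpos, -, -, hy⟩
    · refine ⟨j + 1 + 5, ⟨⟨by omega, le_rfl, hw⟩, fun i hi => hi.2.1⟩, ?_⟩
      have hM : 0 < 2 ^ (j + 1) := by positivity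
      rw [hy, Nat.cast_sub (by omega), n, pow_add 2 (j + 1) 5]
      push_cast
      ring
    · obtain ⟨l, ⟨⟨h5, hl, hwl⟩, hmax⟩, hyl⟩ := ih
      refine ⟨l, ⟨⟨h5, by omega, hwl⟩, fun i ⟨hi5, hi, hwi⟩ => hmax ⟨hi5, ?_, hwi⟩⟩, ?_⟩
      · rcases hi.lt_or_eq with hlt | rfl
        · omega
        · exact absurd hwi hw
      · rw [remainder] at hpos hy
        rw [hy, Nat.cast_sub hpos, hyl]
        push_cast
        ring

end LZEnd

theorem lemma6 (k : ℕ) (hk : 5 ≤ k) :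
    -- (I) all phrases of `S_{k-1}` but the last one are kept
    (∀ i : ℕ, 1 ≤ i → i ≤ LZEnd.numPhrases (LZEnd.S (k - 1)) - 1 →
      LZEnd.phrase (LZEnd.S k) i = LZEnd.phrase (LZEnd.S (k - 1)) i) ∧
    -- (II)
    LZEnd.numPhrases (LZEnd.S (k - 1)) + 1 ≤ LZEnd.numPhrases (LZEnd.S k) ∧
    -- (III), first case
    (LZEnd.w k ≠ LZEnd.lastPhrase (LZEnd.S (k - 1)) →
      ((LZEnd.w k).length : ℚ) = 1 / 8 * (LZEnd.n k : ℚ) + 1 ∧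
      ((LZEnd.x k).length : ℚ) = 3 / 8 * (LZEnd.n k : ℚ) ∧
      ∃ l : ℕ,
        IsGreatest {i : ℕ | 5 ≤ i ∧ i ≤ k ∧
          LZEnd.w i = LZEnd.lastPhrase (LZEnd.S (i - 1))} l ∧
        ((LZEnd.y k).length : ℚ) = 3 / 16 * (LZEnd.n l : ℚ) - ((k : ℚ) - (l : ℚ)) - 1) ∧
    -- (III), second case
    (LZEnd.w k = LZEnd.lastPhrase (LZEnd.S (k - 1)) →
      ((LZEnd.w k).length : ℚ) = 3 / 16 * (LZEnd.n k : ℚ) ∧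
      ((LZEnd.x k).length : ℚ) = 5 / 16 * (LZEnd.n k : ℚ) + 1 ∧
      ((LZEnd.y k).length : ℚ) = 3 / 16 * (LZEnd.n k : ℚ) - 1) ∧
    -- (IV) an earlier occurrence, ending with a phrase that precedes `y_k`
    (2 ≤ (LZEnd.y k).length →
      ∃ j : ℕ, 1 ≤ j ∧ j ≤ LZEnd.numPhrases (LZEnd.S (k - 1)) + 1 ∧
        (LZEnd.y k).dropLast <:+ ((LZEnd.factorization (LZEnd.S k)).take j).flatten) ∧
    (LZEnd.y k ≠ [] →
      LZEnd.numPhrases (LZEnd.S k) = LZEnd.numPhrases (LZEnd.S (k - 1)) + 2 ∧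
      LZEnd.lastPhrase (LZEnd.S k) = LZEnd.y k) := by
  obtain ⟨j, rfl⟩ := Nat.exists_eq_add_of_le' hk
  obtain ⟨E, v, a, b, c, he⟩ := LZEnd.exists_extends j
  refine ⟨fun i hi hi' => he.phrase_eq hi hi', he.numPhrases_le, fun hne => ?_, fun heq => ?_,
    he.exists_source, he.last_of_ne_nil⟩
  · rcases LZEnd.lengthRecursion j with ⟨hw, -⟩ | ⟨-, -, hw, hx, -⟩
    · exact absurd hw hne
    · refine ⟨?_, ?_, LZEnd.exists_isGreatest_length_y j⟩
      · rw [hw, LZEnd.n, pow_add]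
        push_cast
        ring
      · rw [hx, LZEnd.n, pow_add]
        push_cast
        ring
  · rcases LZEnd.lengthRecursion j with ⟨-, -, hw, hx, hy⟩ | ⟨hw, -⟩
    · have hM : 0 < 2 ^ j := by positivity
      refine ⟨?_, ?_, ?_⟩
      · rw [hw, LZEnd.n, pow_add]
        push_cast
        ring
      · rw [hx, LZEnd.n, pow_add]
        push_cast
        ring
      · rw [hy, Nat.cast_sub (by omega), LZEnd.n, pow_add]
        push_cast
        ring
    · exact absurd heq hw
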